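/- Let $\delta>-1$ be a constant and let $(G(n))_{n\ge 1}$ be the linear preferential attachment model in which every new node attaches to an existing node (Model A): $G(1)$ consists of one node $v_1$ with a self loop (so $v_1$ has degree $2$), and, given $G(n)$ with nodes $v_1,\dots,v_n$, the graph $G(n+1)$ is obtained by adding a node $v_{n+1}$ and one edge joining it to one of the existing nodes, the node $v_i$ being chosen with probability $$\frac{D_i(n)+\delta}{\sum_{j=1}^n (D_j(n)+\delta)}=\frac{D_i(n)+\delta}{(2+\delta)n},\qquad 1\le i\le n,$$ where $D_i(n)$ is the degree of $v_i$ in $G(n)$. Let $D_{(1)}(n)\ge D_{(2)}(n)\ge\dots\ge D_{(n)}(n)$ be the order statistics of $D_1(n),\dots,D_n(n)$. Let $(k_n)$ be a sequence of nonnegative integers with $$\liminf_{n\to\infty}\frac{k_n}{(n\log n)^{1/2}}>0\qquad\text{and}\qquad \frac{k_n}{n}\to 0\quad (n\to\infty).$$ Let $M_+((0,\infty])$ be the space of nonnegative Radon measures on $(0,\infty]$ with the vague topology, let $\epsilon_x$ be the unit mass at $x$, and let $\nu_{2+\delta}$ be the measure on $(0,\infty]$ with $\nu_{2+\delta}(x,\infty]=x^{-(2+\delta)}$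 for $x>0$. **Theorem.** (i) The tail empirical measure $$\hat\nu_n=\frac1{k_n}\sum_{i=1}^n \epsilon_{D_i(n)/D_{(k_n)}(n)}$$ converges weakly (in distribution, as a random element of $M_+((0,\infty])$) to the deterministic measure $\nu_{2+\delta}$ as $n\to\infty$. (ii) With $$b(x)=\left(\frac{\Gamma(3+2\delta)}{\Gamma(1+\delta)}\right)^{\frac1{2+\delta}}x^{\frac1{2+\delta}},$$ one has, for every fixed $t>0$, $$\frac{D_{([k_nt])}(n)}{b(n/k_n)}\longrightarrow t^{-\frac1{2+\delta}}\quad\text{in probability as } n\to\infty,$$ where $[\cdot]$ denotes the integer part. -/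

import Mathlib

open MeasureTheory ProbabilityTheory Filter Topology Set
open scoped ENNReal NNReal CompactlySupported

noncomputable section

/-! ## The preferential attachment graphs -/

/-- Finite undirected multigraphs with vertices labelled by natural numbers, given by the multiset
of their edges; the edge `s(i, i)` is a self loop at `i`. -/
abbrev LabelledMultigraph : Type := Multiset (Sym2 ℕ)

/-- The degree of vertex `i` in `g`: the number of edge ends at `i` (a self loop counts twice). -/
def LabelledMultigraph.degree (g : LabelledMultigraph) (i : ℕ) : ℕ :=
  (g.map fun e => e.toMultiset.count i).sum

/-- `G 1, G 2, …` is a linear preferential attachment process with parameter `δ` in which every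
new vertex attaches to one of the existing vertices. `G 1` is the single vertex `1` with a self
loop. Given `G n = g` (a graph on the vertices `1, …, n`), the graph `G (n + 1)` is obtained by
adding the vertex `n + 1` and an edge from it to `i ∈ {1, …, n}`, with probability
`(deg_g i + δ) / ∑ j ≤ n, (deg_g j + δ)`. The value `G 0` plays no role. -/
structure IsPreferentialAttachmentA {Ω : Type*} [MeasurableSpace Ω] (P : Measure Ω) (δ : ℝ)
    (G : ℕ → Ω → LabelledMultigraph) : Prop where
  measurableSet_eq : ∀ n, 1 ≤ n → ∀ g, MeasurableSet {ω | G n ω = g}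
  init : ∀ᵐ ω ∂P, G 1 ω = {s(1, 1)}
  step : ∀ n, 1 ≤ n → ∀ g : LabelledMultigraph, P {ω | G n ω = g} ≠ 0 →
    ∀ i ∈ Finset.Icc 1 n,
      (P[|{ω | G n ω = g}]).real {ω | G (n + 1) ω = s(n + 1, i) ::ₘ g} =
        ((g.degree i : ℝ) + δ) / ∑ j ∈ Finset.Icc 1 n, ((g.degree j : ℝ) + δ)

/-- The order statistic `D_(j)(n)`: the `j`-th largest (`1 ≤ j ≤ n`) of the degrees of the
vertices `1, …, n` of `g`, counted with multiplicity. -/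
def LabelledMultigraph.orderedDegree (g : LabelledMultigraph) (n j : ℕ) : ℕ :=
  (((Finset.Icc 1 n).val.map g.degree).sort (· ≥ ·)).getD (j - 1) 0

/-! ## Radon measures on `(0, ∞]` with the vague topology -/

/-- The space `(0, ∞]`, as a subspace of `[0, ∞]`. Its compact subsets are the closed subsets
which are bounded away from `0`. -/
abbrev PosExtended : Type := Set.Ioi (0 : ℝ≥0∞)

/-- `M_+(E)`, the nonnegative Radon measures on `E`. It is used for `E` locally compact, Hausdorff
and second countable, where these are the Borel measures that are finite on compact sets. -/
def RadonMeasures (E : Type*) [TopologicalSpace E] [MeasurableSpace E] : Type _ :=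
  {μ : Measure E // IsFiniteMeasureOnCompacts μ}

namespace RadonMeasures

variable {E : Type*} [TopologicalSpace E] [MeasurableSpace E]

/-- The vague topology: the coarsest topology that makes `μ ↦ ∫ f dμ` continuous for every
continuous compactly supported `f`. -/
instance : TopologicalSpace (RadonMeasures E) :=
  TopologicalSpace.induced (fun (μ : RadonMeasures E) (f : C_c(E, ℝ)) => ∫ x, f x ∂μ.1)
    Pi.topologicalSpace

/-- `M_+(E)` carries the Borel σ-algebra of the vague topology. -/
instance : MeasurableSpace (RadonMeasures E) := borel _

instance : BorelSpace (RadonMeasures E) := ⟨rfl⟩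

end RadonMeasures

/-- The restriction to `(0, ∞]` of a finite measure on `[0, ∞]`, as an element of
`M_+((0, ∞])`. -/
def restrictPosExtended (μ : Measure ℝ≥0∞) [IsFiniteMeasure μ] : RadonMeasures PosExtended :=
  ⟨μ.comap Subtype.val, inferInstance⟩

/-- The tail empirical measure `(1 / k) ∑_{i = 1}^n ε_{D_i(n) / D_(k)(n)}` on `(0, ∞]`. -/
def tailEmpiricalMeasure (g : LabelledMultigraph) (n k : ℕ) : RadonMeasures PosExtended :=
  restrictPosExtended ((k : ℝ≥0)⁻¹ • ∑ i ∈ Finset.Icc 1 n,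
    Measure.dirac ((g.degree i : ℝ≥0∞) / (g.orderedDegree n k : ℝ≥0∞)))

/-- The measure with density `α y ^ (-α - 1)` on `(0, ∞)` and no mass at `∞`. -/
def powerMeasure (α : ℝ) : Measure PosExtended :=
  Measure.comap Subtype.val (Measure.map ENNReal.ofReal
    ((volume.restrict (Set.Ioi 0)).withDensity fun y : ℝ => ENNReal.ofReal (α * y ^ (-α - 1))))

theorem powerMeasure_apply (α : ℝ) {x : ℝ} (hx : 0 < x) :
    powerMeasure α {y | ENNReal.ofReal x < y.1} =
      ∫⁻ y in Set.Ioi x, ENNReal.ofReal (α * y ^ (-α - 1)) := by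
  have hme : MeasurableEmbedding (Subtype.val : PosExtended → ℝ≥0∞) :=
    MeasurableEmbedding.subtype_coe measurableSet_Ioi
  rw [powerMeasure, hme.comap_apply]
  have h1 : (Subtype.val '' {y : PosExtended | ENNReal.ofReal x < y.1}) =
      Set.Ioi (ENNReal.ofReal x) := by
    ext z
    constructor
    · rintro ⟨y, hy, rfl⟩
      exact hy
    · intro hz
      exact ⟨⟨z, Set.mem_Ioi.2 (lt_of_le_of_lt (zero_le (a := ENNReal.ofReal x)) hz)⟩, hz, rfl⟩
  have h2 : ENNReal.ofReal ⁻¹' Set.Ioi (ENNReal.ofReal x) = Set.Ioi x := by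
    ext z
    simp only [Set.mem_preimage, Set.mem_Ioi]
    constructor
    · intro h
      exact (ENNReal.ofReal_lt_ofReal_iff_of_nonneg hx.le).1 h
    · intro h
      exact (ENNReal.ofReal_lt_ofReal_iff_of_nonneg hx.le).2 h
  rw [h1, Measure.map_apply ENNReal.measurable_ofReal measurableSet_Ioi, h2,
    withDensity_apply _ measurableSet_Ioi, Measure.restrict_restrict measurableSet_Ioi,
    Set.inter_eq_left.2 (Set.Ioi_subset_Ioi hx.le)]

/-- `ν_α (x, ∞] = x ^ (-α)`. -/
theorem powerMeasure_Ioi {α x : ℝ} (hα : 0 < α) (hx : 0 < x) :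
    powerMeasure α {y | ENNReal.ofReal x < y.1} = ENNReal.ofReal (x ^ (-α)) := by
  have hlt : -α - 1 < -1 := by linarith
  rw [powerMeasure_apply α hx, ← ofReal_integral_eq_lintegral_ofReal
    ((integrableOn_Ioi_rpow_of_lt hlt hx).const_mul α), integral_const_mul,
    integral_Ioi_rpow_of_lt hlt hx]
  · congr 1
    rw [show -α - 1 + 1 = -α by ring]
    field_simp
  · refine (ae_restrict_iff' measurableSet_Ioi).2 (Eventually.of_forall fun y hy => ?_)
    have : 0 < y := hx.trans hy
    show 0 ≤ α * y ^ (-α - 1)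
    positivity

theorem powerMeasure_Ioi_lt_top (α : ℝ) {x : ℝ} (hx : 0 < x) :
    powerMeasure α {y | ENNReal.ofReal x < y.1} < ∞ := by
  rcases lt_or_ge 0 α with hα | hα
  · rw [powerMeasure_Ioi hα hx]
    exact ENNReal.ofReal_lt_top
  · rw [powerMeasure_apply α hx, setLIntegral_congr_fun (g := fun _ => 0) measurableSet_Ioi]
    · simp
    · intro y hy
      have : 0 < y := hx.trans hy
      exact ENNReal.ofReal_of_nonpos (mul_nonpos_of_nonpos_of_nonneg hα (by positivity))

/-- `ν_α` as an element of `M_+((0, ∞])`. -/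
def nuMeasure (α : ℝ) : RadonMeasures PosExtended :=
  ⟨powerMeasure α, by
    have : IsLocallyFiniteMeasure (powerMeasure α) := by
      refine ⟨fun y => ?_⟩
      obtain ⟨r, hr0, hr⟩ := ENNReal.lt_iff_exists_real_btwn.1 (show (0 : ℝ≥0∞) < y.1 from y.2)
      refine ⟨{z | ENNReal.ofReal r < z.1}, ?_, powerMeasure_Ioi_lt_top α ?_⟩
      · exact (isOpen_Ioi.preimage continuous_subtype_val).mem_nhds hr.2
      · exact ENNReal.ofReal_pos.1 hr.1
    infer_instance⟩

/-- The scaling function `b(x) = (Γ(3 + 2δ) / Γ(1 + δ)) ^ (1 / (2 + δ)) x ^ (1 / (2 + δ))`. -/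
def scaleB (δ x : ℝ) : ℝ :=
  (Real.Gamma (3 + 2 * δ) / Real.Gamma (1 + δ)) ^ (1 / (2 + δ)) * x ^ (1 / (2 + δ))

end

/-! Write `N_n(m)` for the number of vertices of degree at least `m` at time `n`, `p_m` for
`tailWeight δ m`, and `Y_n(m) = N_n(m) - n p_m`. Attaching to a vertex of degree `m` raises `N(m +
1)` by one and nothing else changes it. With `a = (m + δ) / ((2 + δ) n)`, the recurrence for `p`
makes the conditional mean of `Y_{n+1}(m + 1)` equal to `(1 - a) Y_n(m + 1) + a Y_n(m)`. For `m ≤ n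
+ 1` this is a convex combination, and the remaining noise is a centred Bernoulli variable.
Convexity of the square and induction on `n` give `E Y_n(m)² ≤ n`, uniformly in `m`
(`tsum_sq_tailDeviation_le`).

By Chebyshev, `Y_n(m) / k_n → 0` in probability at any deterministic level, since `n / k_n² → 0`. As
`m ^ (2 + δ) p_m` converges to a ratio of Gamma values, taking `m = ⌈y b(n / k_n)⌉` gives `N_n(m) /
k_n → y ^ (-(2 + δ))` (`holdsWhp_tailCount`).

Part (ii) follows by inversion, because `m ≤ D_(j)` exactly when `j ≤ N(m)`. For (i), `D_(k_n) / b →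
1` traps the random threshold `x D_(k_n)` between two deterministic ones, so the mass of each `(x,
∞]` converges in probability. These masses control vague convergence
(`PosExtended.tendsto_of_tendsto_tail`), and convergence in probability to a constant gives
convergence in distribution. -/

/-! ## The limiting degree tail -/

/-- The limiting proportion of vertices of degree at least `m`, for `1 ≤ m`. -/
noncomputable def tailWeight (δ : ℝ) (m : ℕ) : ℝ :=
  ∏ j ∈ Finset.range (m - 1), (1 + δ + j) / (3 + 2 * δ + j)

theorem tailWeight_one (δ : ℝ) : tailWeight δ 1 = 1 := by simp [tailWeight]

theorem tailWeight_succ (δ : ℝ) {m : ℕ} (hm : 1 ≤ m) :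
    tailWeight δ (m + 1) = tailWeight δ m * ((m + δ) / (m + 2 + 2 * δ)) := by
  obtain ⟨m, rfl⟩ := Nat.exists_eq_add_of_le' hm
  simp only [tailWeight, Nat.add_sub_cancel, Finset.prod_range_succ]
  push_cast
  congr 2 <;> ring

/-- This is the stationarity relation that cancels the drift of the centred counts. -/
theorem tailWeight_recurrence {δ : ℝ} (hδ : -1 < δ) {m : ℕ} (hm : 1 ≤ m) :
    (m + δ) * (tailWeight δ m - tailWeight δ (m + 1)) = (2 + δ) * tailWeight δ (m + 1) := by
  have hm' : (1 : ℝ) ≤ m := by exact_mod_cast hm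
  have : (m + 2 + 2 * δ : ℝ) ≠ 0 := by linarith
  have h : tailWeight δ (m + 1) * (m + 2 + 2 * δ) = tailWeight δ m * (m + δ) := by
    rw [tailWeight_succ δ hm, mul_assoc, div_mul_cancel₀ _ this]
  linear_combination -h

theorem tailWeight_nonneg {δ : ℝ} (hδ : -1 < δ) (m : ℕ) : 0 ≤ tailWeight δ m := by
  refine Finset.prod_nonneg fun j _ => div_nonneg ?_ ?_
  · have : (0 : ℝ) ≤ j := j.cast_nonneg
    linarith
  · have : (0 : ℝ) ≤ j := j.cast_nonneg
    linarith

/-- The product decreases in `m`, since `(m + 1)(m + δ) ≤ m (m + 2 + 2δ)`. It controls the centring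
at levels above the maximal degree. -/
theorem mul_tailWeight_le_one {δ : ℝ} (hδ : -1 < δ) {m : ℕ} (hm : 1 ≤ m) :
    m * tailWeight δ m ≤ 1 := by
  induction m, hm using Nat.le_induction with
  | base => simp [tailWeight_one]
  | succ m hm ih =>
    have hm' : (1 : ℝ) ≤ m := by exact_mod_cast hm
    have h0 : (0 : ℝ) < m + 2 + 2 * δ := by linarith
    have hq := tailWeight_nonneg hδ m
    refine le_trans ?_ ih
    rw [tailWeight_succ δ hm]
    have h1 : ((m : ℝ) + 1) * ((m + δ) / (m + 2 + 2 * δ)) ≤ m := by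
      rw [← mul_div_assoc, div_le_iff₀ h0]
      nlinarith
    push_cast
    calc ((m : ℝ) + 1) * (tailWeight δ m * ((m + δ) / (m + 2 + 2 * δ)))
        = ((m : ℝ) + 1) * ((m + δ) / (m + 2 + 2 * δ)) * tailWeight δ m := by ring
      _ ≤ m * tailWeight δ m := by gcongr

/-- The weight is a quotient of two of Euler's products for the Gamma function. The shift by 2
matches the `n + 1` factors of `Real.GammaSeq _ n`. -/
theorem tendsto_rpow_mul_tailWeight {δ : ℝ} (hδ : -1 < δ) :
    Tendsto (fun m : ℕ => (m : ℝ) ^ (2 + δ) * tailWeight δ m) atTop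
      (𝓝 (Real.Gamma (3 + 2 * δ) / Real.Gamma (1 + δ))) := by
  rw [← tendsto_add_atTop_iff_nat 2]
  have h1 := (Real.GammaSeq_tendsto_Gamma (3 + 2 * δ)).div (Real.GammaSeq_tendsto_Gamma (1 + δ))
    (Real.Gamma_pos_of_pos (by linarith)).ne'
  have h2 : Tendsto (fun n : ℕ => (((n : ℝ) + 2) / n) ^ (2 + δ)) atTop (𝓝 (1 ^ (2 + δ))) := by
    refine Tendsto.rpow_const ?_ (Or.inl one_ne_zero)
    have h3 : Tendsto (fun n : ℕ => 1 + 2 / (n : ℝ)) atTop (𝓝 (1 + 0)) :=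
      tendsto_const_nhds.add (tendsto_const_div_atTop_nhds_zero_nat 2)
    rw [add_zero] at h3
    refine h3.congr' ?_
    filter_upwards [eventually_gt_atTop 0] with n hn
    have : (n : ℝ) ≠ 0 := by exact_mod_cast hn.ne'
    field_simp
  have h3 := h2.mul h1
  rw [Real.one_rpow, one_mul] at h3
  refine h3.congr' ?_
  filter_upwards [eventually_gt_atTop 0] with n hn
  have hn' : (0 : ℝ) < n := by exact_mod_cast hn
  have hA : ∏ j ∈ Finset.range (n + 1), (1 + δ + (j : ℝ)) ≠ 0 :=
    Finset.prod_ne_zero_iff.2 fun j _ => by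
      have : (0 : ℝ) ≤ j := j.cast_nonneg
      linarith
  have hB : ∏ j ∈ Finset.range (n + 1), (3 + 2 * δ + (j : ℝ)) ≠ 0 :=
    Finset.prod_ne_zero_iff.2 fun j _ => by
      have : (0 : ℝ) ≤ j := j.cast_nonneg
      linarith
  have hpow : (n : ℝ) ^ (3 + 2 * δ) = (n : ℝ) ^ (1 + δ) * (n : ℝ) ^ (2 + δ) := by
    rw [← Real.rpow_add hn']
    congr 1
    ring
  have hn1 := (Real.rpow_pos_of_pos hn' (1 + δ)).ne'
  have hn2 := (Real.rpow_pos_of_pos hn' (2 + δ)).ne'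
  have hf : (n.factorial : ℝ) ≠ 0 := by exact_mod_cast n.factorial_ne_zero
  rw [Real.div_rpow (by positivity) hn'.le]
  simp only [Pi.div_apply, Real.GammaSeq, hpow, tailWeight, Finset.prod_div_distrib,
    show n + 2 - 1 = n + 1 from rfl]
  push_cast
  field_simp

theorem scaleB_rpow {δ x : ℝ} (hδ : -1 < δ) (hx : 0 ≤ x) :
    scaleB δ x ^ (2 + δ) = Real.Gamma (3 + 2 * δ) / Real.Gamma (1 + δ) * x := by
  have h1 := Real.Gamma_pos_of_pos (show 0 < 3 + 2 * δ by linarith)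
  have h2 := Real.Gamma_pos_of_pos (show 0 < 1 + δ by linarith)
  have h3 : 2 + δ ≠ 0 := by linarith
  rw [scaleB, Real.mul_rpow (by positivity) (by positivity), ← Real.rpow_mul (by positivity),
    ← Real.rpow_mul hx, one_div_mul_cancel h3, Real.rpow_one, Real.rpow_one]

theorem scaleB_pos {δ x : ℝ} (hδ : -1 < δ) (hx : 0 < x) : 0 < scaleB δ x := by
  have h1 := Real.Gamma_pos_of_pos (show 0 < 3 + 2 * δ by linarith)
  have h2 := Real.Gamma_pos_of_pos (show 0 < 1 + δ by linarith)
  unfold scaleB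
  positivity

theorem tendsto_scaleB {δ : ℝ} (hδ : -1 < δ) : Tendsto (scaleB δ) atTop atTop := by
  have h1 := Real.Gamma_pos_of_pos (show 0 < 3 + 2 * δ by linarith)
  have h2 := Real.Gamma_pos_of_pos (show 0 < 1 + δ by linarith)
  have h3 : 0 < 2 + δ := by linarith
  exact (tendsto_rpow_atTop (by positivity)).const_mul_atTop (by positivity)

/-- Since `b(u) ^ (2 + δ) = C u`, with `C` the limit of `m ^ (2 + δ) p_m`, one has `u p_m = (m /
b(u)) ^ (-(2 + δ)) * (m ^ (2 + δ) p_m / C)`. -/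
theorem tendsto_mul_tailWeight_ceil {δ : ℝ} (hδ : -1 < δ) {u : ℕ → ℝ} (hu : Tendsto u atTop atTop)
    {y : ℝ} (hy : 0 < y) :
    Tendsto (fun n => u n * tailWeight δ ⌈y * scaleB δ (u n)⌉₊) atTop (𝓝 (y ^ (-(2 + δ)))) := by
  have hG1 := Real.Gamma_pos_of_pos (show 0 < 3 + 2 * δ by linarith)
  have hG2 := Real.Gamma_pos_of_pos (show 0 < 1 + δ by linarith)
  have hb : Tendsto (fun n => scaleB δ (u n)) atTop atTop := (tendsto_scaleB hδ).comp hu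
  have hm : Tendsto (fun n => ⌈y * scaleB δ (u n)⌉₊) atTop atTop :=
    tendsto_nat_ceil_atTop.comp (hb.const_mul_atTop hy)
  have h1 := (tendsto_rpow_mul_tailWeight hδ).comp hm
  have h2 : Tendsto (fun n => (⌈y * scaleB δ (u n)⌉₊ : ℝ) / scaleB δ (u n)) atTop (𝓝 y) :=
    (tendsto_nat_ceil_mul_div_atTop hy.le).comp hb
  have h3 := (h2.rpow_const (p := -(2 + δ)) (Or.inl hy.ne')).mul
    (h1.div_const (Real.Gamma (3 + 2 * δ) / Real.Gamma (1 + δ)))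
  rw [div_self (by positivity), mul_one] at h3
  refine h3.congr' ?_
  filter_upwards [hu.eventually_gt_atTop 0] with n hn
  have hbn := scaleB_pos hδ hn
  have hmn : (0 : ℝ) < (⌈y * scaleB δ (u n)⌉₊ : ℝ) := by
    exact_mod_cast Nat.ceil_pos.2 (by positivity)
  simp only [Function.comp]
  rw [Real.rpow_neg (by positivity), Real.div_rpow hmn.le hbn.le, scaleB_rpow hδ hn.le]
  have := (Real.rpow_pos_of_pos hmn (2 + δ)).ne'
  field_simp

/-! ## Degrees in one attachment step -/

namespace LabelledMultigraph

theorem degree_cons (a b : ℕ) (g : LabelledMultigraph) (j : ℕ) :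
    LabelledMultigraph.degree (s(a, b) ::ₘ g) j =
      (if j = a then 1 else 0) + (if j = b then 1 else 0) + g.degree j := by
  have h : (s(a, b)).toMultiset = {a, b} := rfl
  simp only [degree, Multiset.map_cons, Multiset.sum_cons, h, Multiset.insert_eq_cons,
    Multiset.count_cons, Multiset.count_singleton]
  ring

/-- The number of vertices among `1, …, n` whose degree is at least `m`. -/
def tailCount (g : LabelledMultigraph) (n m : ℕ) : ℕ :=
  ((Finset.Icc 1 n).filter fun i => m ≤ g.degree i).card

/-- The number of vertices among `1, …, n` whose degree is `m`. -/
def exactCount (g : LabelledMultigraph) (n m : ℕ) : ℕ :=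
  ((Finset.Icc 1 n).filter fun i => g.degree i = m).card

theorem tailCount_eq_add (g : LabelledMultigraph) (n m : ℕ) :
    g.tailCount n m = g.tailCount n (m + 1) + g.exactCount n m := by
  rw [tailCount, tailCount, exactCount, ← Finset.card_union_of_disjoint]
  · congr 1
    ext i
    simp only [Finset.mem_filter, Finset.mem_union]
    grind
  · rw [Finset.disjoint_filter]
    intro i _ h1 h2
    omega

/-- The degree constraints satisfied by every state at time `n` of the attachment process. -/
structure IsAttachmentState (n : ℕ) (g : LabelledMultigraph) : Prop where
  one_le_degree : ∀ i ∈ Finset.Icc 1 n, 1 ≤ g.degree i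
  degree_eq_zero : ∀ i, i ∉ Finset.Icc 1 n → g.degree i = 0
  sum_degree : ∑ i ∈ Finset.Icc 1 n, g.degree i = 2 * n

theorem isAttachmentState_one : IsAttachmentState 1 {s(1, 1)} := by
  have h : ∀ i, LabelledMultigraph.degree {s(1, 1)} i = if i = 1 then 2 else 0 := by
    intro i
    rw [← Multiset.cons_zero, degree_cons]
    split_ifs <;> simp [degree]
  refine ⟨?_, ?_, ?_⟩
  · intro i hi
    simp at hi
    simp [h, hi]
  · intro i hi
    simp at hi
    simp [h, hi]
  · simp [h]

namespace IsAttachmentState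

variable {n : ℕ} {g : LabelledMultigraph}

theorem cons (hg : IsAttachmentState n g) {i : ℕ} (hi : i ∈ Finset.Icc 1 n) :
    IsAttachmentState (n + 1) (s(n + 1, i) ::ₘ g) := by
  have hi' := Finset.mem_Icc.1 hi
  refine ⟨?_, ?_, ?_⟩
  · intro j hj
    rw [degree_cons]
    rcases eq_or_ne j (n + 1) with rfl | hne
    · rw [if_pos rfl]
      omega
    · have := hg.one_le_degree j (by simp at hj ⊢; omega)
      omega
  · intro j hj
    have h0 := hg.degree_eq_zero j (by simp at hj ⊢; omega)
    rw [degree_cons, h0, if_neg, if_neg]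
    all_goals
      simp at hj
      omega
  · rw [Finset.sum_congr rfl fun j _ => degree_cons (n + 1) i g j, Finset.sum_add_distrib,
      Finset.sum_add_distrib, Finset.sum_ite_eq', Finset.sum_ite_eq',
      Finset.sum_Icc_succ_top (by omega), hg.sum_degree, hg.degree_eq_zero (n + 1) (by simp),
      if_pos (by simp), if_pos (by simp; omega)]
    ring

/-- The other `n - 1` vertices use at least one each of the `2n` edge ends. -/
theorem degree_le (hg : IsAttachmentState n g) {i : ℕ} (hi : i ∈ Finset.Icc 1 n) :
    g.degree i ≤ n + 1 := by
  have h1 := Finset.add_sum_erase _ g.degree hi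
  have h2 : ((Finset.Icc 1 n).erase i).card • 1 ≤ ∑ j ∈ (Finset.Icc 1 n).erase i, g.degree j :=
    Finset.card_nsmul_le_sum _ _ _ fun j hj => hg.one_le_degree j (Finset.mem_of_mem_erase hj)
  rw [Finset.card_erase_of_mem hi, Nat.card_Icc, smul_eq_mul] at h2
  rw [hg.sum_degree] at h1
  omega

theorem tailCount_one (hg : IsAttachmentState n g) : g.tailCount n 1 = n := by
  rw [tailCount, Finset.filter_true_of_mem fun i hi => hg.one_le_degree i hi, Nat.card_Icc]
  omega

theorem tailCount_eq_zero (hg : IsAttachmentState n g) {m : ℕ} (hm : n + 1 < m) :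
    g.tailCount n m = 0 := by
  rw [tailCount, Finset.card_eq_zero, Finset.filter_eq_empty_iff]
  intro i hi
  have := hg.degree_le hi
  omega

/-- The new vertex has degree 1, below `m + 1`, so only `i` can cross the level. -/
theorem tailCount_cons (hg : IsAttachmentState n g) {i : ℕ} (hi : i ∈ Finset.Icc 1 n) {m : ℕ}
    (hm : 1 ≤ m) :
    LabelledMultigraph.tailCount (s(n + 1, i) ::ₘ g) (n + 1) (m + 1) =
      g.tailCount n (m + 1) + if g.degree i = m then 1 else 0 := by
  have hi' := Finset.mem_Icc.1 hi
  have h0 := hg.degree_eq_zero (n + 1) (by simp)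
  simp only [tailCount, Finset.card_filter]
  rw [Finset.sum_Icc_succ_top (by omega), degree_cons, h0, if_neg, add_zero]
  · have h1 : (if g.degree i = m then 1 else 0) =
        ∑ j ∈ Finset.Icc 1 n, if j = i then (if g.degree j = m then 1 else 0) else 0 := by
      rw [Finset.sum_ite_eq', if_pos hi]
    rw [h1, ← Finset.sum_add_distrib]
    refine Finset.sum_congr rfl fun j hj => ?_
    have hj' := Finset.mem_Icc.1 hj
    rw [degree_cons, if_neg (show j ≠ n + 1 by omega)]
    split_ifs <;> omega
  · rw [if_pos rfl, if_neg (by omega)]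
    omega

end IsAttachmentState

/-- The probability that the new vertex is attached to `i`. -/
noncomputable def attachProb (δ : ℝ) (n : ℕ) (g : LabelledMultigraph) (i : ℕ) : ℝ :=
  ((g.degree i : ℝ) + δ) / ((2 + δ) * n)

namespace IsAttachmentState

variable {n : ℕ} {g : LabelledMultigraph} {δ : ℝ}

theorem sum_degree_add (hg : IsAttachmentState n g) (δ : ℝ) :
    ∑ j ∈ Finset.Icc 1 n, ((g.degree j : ℝ) + δ) = (2 + δ) * n := by
  rw [Finset.sum_add_distrib, ← Nat.cast_sum, hg.sum_degree]
  simp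
  ring

theorem attachProb_nonneg (hg : IsAttachmentState n g) (hδ : -1 < δ) {i : ℕ}
    (hi : i ∈ Finset.Icc 1 n) : 0 ≤ attachProb δ n g i := by
  have h : (1 : ℝ) ≤ g.degree i := by exact_mod_cast hg.one_le_degree i hi
  exact div_nonneg (by linarith) (mul_nonneg (by linarith) n.cast_nonneg)

theorem sum_attachProb (hg : IsAttachmentState n g) (hδ : -1 < δ) (hn : 1 ≤ n) :
    ∑ i ∈ Finset.Icc 1 n, attachProb δ n g i = 1 := by
  have hn' : (0 : ℝ) < n := by exact_mod_cast hn
  simp only [attachProb]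
  rw [← Finset.sum_div, hg.sum_degree_add, div_self]
  exact mul_ne_zero (by linarith) hn'.ne'

theorem sum_attachProb_filter (δ : ℝ) (n m : ℕ) (g : LabelledMultigraph) :
    ∑ i ∈ Finset.Icc 1 n, (if g.degree i = m then attachProb δ n g i else 0) =
      (m + δ) / ((2 + δ) * n) * (g.tailCount n m - g.tailCount n (m + 1)) := by
  rw [← Finset.sum_filter, Finset.sum_congr rfl (g := fun _ => (m + δ) / ((2 + δ) * n)),
    Finset.sum_const, tailCount_eq_add g n m, nsmul_eq_mul, exactCount]
  · push_cast
    ring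
  · intro i hi
    rw [attachProb, (Finset.mem_filter.1 hi).2]

end IsAttachmentState

/-- The deviation of the number of vertices of degree at least `m` from its asymptotic mean. -/
noncomputable def tailDeviation (δ : ℝ) (n m : ℕ) (g : LabelledMultigraph) : ℝ :=
  g.tailCount n m - n * tailWeight δ m

namespace IsAttachmentState

variable {n : ℕ} {g : LabelledMultigraph} {δ : ℝ}

theorem tailDeviation_one (hg : IsAttachmentState n g) : tailDeviation δ n 1 g = 0 := by
  simp [tailDeviation, hg.tailCount_one, tailWeight_one]

theorem sq_tailDeviation_le_one (hg : IsAttachmentState n g) (hδ : -1 < δ) {m : ℕ}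
    (hm : n + 1 < m) : tailDeviation δ n m g ^ 2 ≤ 1 := by
  have h1 := mul_tailWeight_le_one hδ (show 1 ≤ m by omega)
  have h2 := tailWeight_nonneg hδ m
  have h3 : (n : ℝ) ≤ m := by exact_mod_cast (by omega : n ≤ m)
  have h4 : (0 : ℝ) ≤ n := n.cast_nonneg
  rw [tailDeviation, hg.tailCount_eq_zero hm, Nat.cast_zero, zero_sub, neg_sq]
  have h5 : n * tailWeight δ m ≤ 1 := (mul_le_mul_of_nonneg_right h3 h2).trans h1
  exact pow_le_one₀ (by positivity) h5

/-- One step of the attachment process moves the deviation at level `m + 1` to a convex combination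
of the deviations at levels `m` and `m + 1`, up to noise of variance at most `1 / 4`. -/
theorem sum_attachProb_mul_sq_le (hg : IsAttachmentState n g) (hδ : -1 < δ) (hn : 1 ≤ n) {m : ℕ}
    (hm : 1 ≤ m) (hmn : m ≤ n + 1) :
    ∑ i ∈ Finset.Icc 1 n,
        attachProb δ n g i * tailDeviation δ (n + 1) (m + 1) (s(n + 1, i) ::ₘ g) ^ 2 ≤
      (1 - (m + δ) / ((2 + δ) * n)) * tailDeviation δ n (m + 1) g ^ 2 +
        (m + δ) / ((2 + δ) * n) * tailDeviation δ n m g ^ 2 + 1 / 4 := by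
  have hn' : (1 : ℝ) ≤ n := by exact_mod_cast hn
  have hm' : (1 : ℝ) ≤ m := by exact_mod_cast hm
  have hmn' : (m : ℝ) ≤ n + 1 := by exact_mod_cast hmn
  have hd : 0 < (2 + δ) * n := mul_pos (by linarith) (by linarith)
  set a := (m + δ) / ((2 + δ) * n) with ha
  set Y := tailDeviation δ n (m + 1) g with hY
  set Z := tailDeviation δ n m g with hZ
  set q := tailWeight δ (m + 1) with hq
  set A := ∑ i ∈ Finset.Icc 1 n, (if g.degree i = m then attachProb δ n g i else 0) with hA
  have ha0 : 0 ≤ a := div_nonneg (by linarith) hd.le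
  -- Here `m + δ ≤ n + 1 + δ ≤ (2 + δ) n`, because `(1 + δ)(n - 1) ≥ 0`.
  have ha1 : a ≤ 1 := by
    rw [ha, div_le_one hd]
    nlinarith
  have hterm : ∀ i ∈ Finset.Icc 1 n,
      attachProb δ n g i * tailDeviation δ (n + 1) (m + 1) (s(n + 1, i) ::ₘ g) ^ 2 =
        attachProb δ n g i * (Y - q) ^ 2 +
          (if g.degree i = m then attachProb δ n g i else 0) * (2 * (Y - q) + 1) := by
    intro i hi
    rw [tailDeviation, hg.tailCount_cons hi hm, hY, tailDeviation, ← hq]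
    split_ifs <;> push_cast <;> ring
  -- `A` is the probability of a jump, so the left side is the conditional mean of the new
  -- deviation.
  have hAeq : Y - q + A = (1 - a) * Y + a * Z := by
    have h1 : a * n * (tailWeight δ m - q) = q := by
      have h2 := tailWeight_recurrence hδ hm
      have h3 : (2 + δ) ≠ 0 := by linarith
      have h4 : (n : ℝ) ≠ 0 := by linarith
      rw [← hq] at h2
      have h5 : a * n = (m + δ) / (2 + δ) := by
        rw [ha]
        field_simp
      rw [h5, div_mul_eq_mul_div, h2, mul_div_cancel_left₀ _ h3]
    rw [hA, sum_attachProb_filter, ← ha, hY, hZ, tailDeviation, tailDeviation, ← hq]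
    linear_combination h1
  rw [Finset.sum_congr rfl hterm, Finset.sum_add_distrib, ← Finset.sum_mul, ← Finset.sum_mul,
    hg.sum_attachProb hδ hn, ← hA]
  -- Second moment as squared mean plus the Bernoulli variance `A (1 - A)`, which is at most `1 /
  -- 4`.
  have h1 : 1 * (Y - q) ^ 2 + A * (2 * (Y - q) + 1) = ((1 - a) * Y + a * Z) ^ 2 + A * (1 - A) := by
    rw [← hAeq]
    ring
  have h2 : ((1 - a) * Y + a * Z) ^ 2 = (1 - a) * Y ^ 2 + a * Z ^ 2 - a * (1 - a) * (Y - Z) ^ 2 := by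
    ring
  have h3 : 0 ≤ a * (1 - a) * (Y - Z) ^ 2 := by
    have := sub_nonneg.2 ha1
    positivity
  rw [h1, h2]
  nlinarith [sq_nonneg (A - 1 / 2)]

end IsAttachmentState

theorem sq_tailDeviation_singleton_le_one {δ : ℝ} (hδ : -1 < δ) {m : ℕ} (hm : 1 ≤ m) :
    tailDeviation δ 1 m {s(1, 1)} ^ 2 ≤ 1 := by
  have h1 := tailWeight_nonneg hδ m
  have h2 := mul_tailWeight_le_one hδ hm
  have hm' : (1 : ℝ) ≤ m := by exact_mod_cast hm
  have h3 : tailWeight δ m ≤ 1 := (le_mul_of_one_le_left h1 hm').trans h2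
  have h4 : LabelledMultigraph.tailCount {s(1, 1)} 1 m ≤ 1 :=
    (Finset.card_filter_le _ _).trans (by simp)
  have h5 : (LabelledMultigraph.tailCount {s(1, 1)} 1 m : ℝ) ≤ 1 := by exact_mod_cast h4
  have h6 : (0 : ℝ) ≤ (LabelledMultigraph.tailCount {s(1, 1)} 1 m : ℝ) := Nat.cast_nonneg _
  rw [tailDeviation, Nat.cast_one, one_mul, sq_le_one_iff_abs_le_one, abs_le]
  constructor <;> linarith

end LabelledMultigraph

/-! ## The second moment of the degree counts -/

/-- With countably many states, expectations become series over graphs and no conditional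
expectations are needed. -/
instance : Countable LabelledMultigraph :=
  inferInstanceAs (Countable (Multiset (Sym2 ℕ)))

namespace IsPreferentialAttachmentA

open LabelledMultigraph

variable {Ω : Type*} [MeasurableSpace Ω] {P : Measure Ω} {δ : ℝ}
  {G : ℕ → Ω → LabelledMultigraph}

theorem tsum_measure_inter (hG : IsPreferentialAttachmentA P δ G) {n : ℕ} (hn : 1 ≤ n) {A : Set Ω}
    (hA : MeasurableSet A) : ∑' g, P ({ω | G n ω = g} ∩ A) = P A := by
  rw [← measure_iUnion]
  · congr 1
    ext ω
    simp
  · intro g g' hne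
    refine Set.disjoint_left.2 fun ω h1 h2 => hne ?_
    exact h1.1.symm.trans h2.1
  · exact fun g => (hG.measurableSet_eq n hn g).inter hA

variable [IsProbabilityMeasure P]

theorem measure_succ_eq_tsum (hG : IsPreferentialAttachmentA P δ G) {n : ℕ} (hn : 1 ≤ n)
    (h : LabelledMultigraph) :
    P {ω | G (n + 1) ω = h} =
      ∑' g, P {ω | G n ω = g} * P[|{ω | G n ω = g}] {ω | G (n + 1) ω = h} := by
  rw [← hG.tsum_measure_inter hn (hG.measurableSet_eq (n + 1) (by omega) h)]
  refine tsum_congr fun g => ?_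
  rw [mul_comm, cond_mul_eq_inter (hG.measurableSet_eq n hn g)]

theorem tsum_measure_eq_one (hG : IsPreferentialAttachmentA P δ G) {n : ℕ} (hn : 1 ≤ n) :
    ∑' g, P {ω | G n ω = g} = 1 := by
  simpa using hG.tsum_measure_inter hn MeasurableSet.univ

theorem cond_step (hG : IsPreferentialAttachmentA P δ G) {n : ℕ} (hn : 1 ≤ n)
    {g : LabelledMultigraph} (hP : P {ω | G n ω = g} ≠ 0) (hg : IsAttachmentState n g) {i : ℕ}
    (hi : i ∈ Finset.Icc 1 n) :
    P[|{ω | G n ω = g}] {ω | G (n + 1) ω = s(n + 1, i) ::ₘ g} =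
      ENNReal.ofReal (attachProb δ n g i) := by
  have := cond_isProbabilityMeasure hP
  have h := hG.step n hn g hP i hi
  rw [hg.sum_degree_add] at h
  rw [attachProb, ← h, Measure.real, ENNReal.ofReal_toReal (measure_ne_top _ _)]

theorem injOn_cons (n : ℕ) (g : LabelledMultigraph) :
    Set.InjOn (fun i => (s(n + 1, i) ::ₘ g : LabelledMultigraph)) (Finset.Icc 1 n) := by
  intro i _ j _ hij
  have h := (Multiset.cons_inj_left g).1 hij
  rcases Sym2.eq_iff.1 h with h | h
  · exact h.2
  · exact h.2.trans h.1

/-- The probabilities of the admissible attachments already sum to one, leaving no mass for other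
graphs. -/
theorem cond_eq_zero (hG : IsPreferentialAttachmentA P δ G) (hδ : -1 < δ) {n : ℕ} (hn : 1 ≤ n)
    {g : LabelledMultigraph} (hP : P {ω | G n ω = g} ≠ 0) (hg : IsAttachmentState n g)
    {h : LabelledMultigraph}
    (hh : h ∉ (Finset.Icc 1 n).image fun i => (s(n + 1, i) ::ₘ g : LabelledMultigraph)) :
    P[|{ω | G n ω = g}] {ω | G (n + 1) ω = h} = 0 := by
  have := cond_isProbabilityMeasure hP
  set ν := P[|{ω | G n ω = g}] with hν
  set H := (Finset.Icc 1 n).image fun i => (s(n + 1, i) ::ₘ g : LabelledMultigraph) with hH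
  have h1 : ∑ h' ∈ H, ν {ω | G (n + 1) ω = h'} = 1 := by
    rw [hH, Finset.sum_image (injOn_cons n g),
      Finset.sum_congr rfl fun i hi => hG.cond_step hn hP hg hi,
      ← ENNReal.ofReal_sum_of_nonneg fun i hi => hg.attachProb_nonneg hδ hi,
      hg.sum_attachProb hδ hn, ENNReal.ofReal_one]
  have h2 : ∑ h' ∈ insert h H, ν {ω | G (n + 1) ω = h'} ≤ 1 := by
    rw [← measure_biUnion_finset]
    · exact prob_le_one
    · intro a _ b _ hne
      refine Set.disjoint_left.2 fun ω h3 h4 => hne ?_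
      exact h3.symm.trans h4
    · exact fun h' _ => hG.measurableSet_eq (n + 1) (by omega) h'
  rw [Finset.sum_insert hh, h1] at h2
  by_contra h0
  have : (1 : ℝ≥0∞) < ν {ω | G (n + 1) ω = h} + 1 := by
    rw [add_comm]
    exact ENNReal.lt_add_right ENNReal.one_ne_top h0
  exact absurd h2 this.not_ge

theorem isAttachmentState (hG : IsPreferentialAttachmentA P δ G) (hδ : -1 < δ) {n : ℕ}
    (hn : 1 ≤ n) : ∀ g, P {ω | G n ω = g} ≠ 0 → IsAttachmentState n g := by
  induction n, hn using Nat.le_induction with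
  | base =>
    intro g hg
    by_contra hne
    refine hg (measure_mono_null ?_ (ae_iff.1 hG.init))
    rintro ω rfl h1
    exact hne (h1 ▸ isAttachmentState_one)
  | succ n hn ih =>
    intro h hh
    rw [hG.measure_succ_eq_tsum hn, Ne, ENNReal.tsum_eq_zero, not_forall] at hh
    obtain ⟨g, hg⟩ := hh
    have hP := left_ne_zero_of_mul hg
    by_contra hne
    refine right_ne_zero_of_mul hg (hG.cond_eq_zero hδ hn hP (ih g hP) fun hmem => hne ?_)
    obtain ⟨i, hi, rfl⟩ := Finset.mem_image.1 hmem
    exact (ih g hP).cons hi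

/-- The one-step law of total expectation. Values in `ℝ≥0∞` allow the sums to be exchanged freely.
-/
theorem tsum_succ (hG : IsPreferentialAttachmentA P δ G) (hδ : -1 < δ) {n : ℕ} (hn : 1 ≤ n)
    (φ : LabelledMultigraph → ℝ≥0∞) :
    ∑' h, P {ω | G (n + 1) ω = h} * φ h =
      ∑' g, P {ω | G n ω = g} *
        ∑ i ∈ Finset.Icc 1 n, ENNReal.ofReal (attachProb δ n g i) * φ (s(n + 1, i) ::ₘ g) := by
  have h1 : ∀ h, P {ω | G (n + 1) ω = h} * φ h = ∑' g, P {ω | G n ω = g} *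
      (P[|{ω | G n ω = g}] {ω | G (n + 1) ω = h} * φ h) := by
    intro h
    rw [hG.measure_succ_eq_tsum hn, ← ENNReal.tsum_mul_right]
    simp only [mul_assoc]
  rw [tsum_congr h1, ENNReal.tsum_comm]
  refine tsum_congr fun g => ?_
  rw [ENNReal.tsum_mul_left]
  rcases eq_or_ne (P {ω | G n ω = g}) 0 with hP | hP
  · rw [hP, zero_mul, zero_mul]
  have hg := hG.isAttachmentState hδ hn g hP
  congr 1
  rw [tsum_eq_sum fun h hh => by rw [hG.cond_eq_zero hδ hn hP hg hh, zero_mul],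
    Finset.sum_image (injOn_cons n g)]
  exact Finset.sum_congr rfl fun i hi => by rw [hG.cond_step hn hP hg hi]

/-- The mean square deviation of the number of vertices of degree at least `m` is at most `n`. -/
theorem tsum_sq_tailDeviation_le (hG : IsPreferentialAttachmentA P δ G) (hδ : -1 < δ) {n : ℕ}
    (hn : 1 ≤ n) : ∀ m, 1 ≤ m →
      ∑' g, P {ω | G n ω = g} * ENNReal.ofReal (tailDeviation δ n m g ^ 2) ≤ n := by
  have hle : ∀ n, 1 ≤ n → ∀ m, (∀ g, P {ω | G n ω = g} ≠ 0 → tailDeviation δ n m g ^ 2 ≤ 1) →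
      ∑' g, P {ω | G n ω = g} * ENNReal.ofReal (tailDeviation δ n m g ^ 2) ≤ 1 := by
    intro n hn m h
    rw [← hG.tsum_measure_eq_one hn]
    refine ENNReal.tsum_le_tsum fun g => ?_
    rcases eq_or_ne (P {ω | G n ω = g}) 0 with hP | hP
    · rw [hP, zero_mul]
    · exact mul_le_of_le_one_right' (ENNReal.ofReal_le_one.2 (h g hP))
  induction n, hn using Nat.le_induction with
  | base =>
    intro m hm
    rw [Nat.cast_one]
    refine hle 1 le_rfl m fun g hg => ?_
    have h1 : g = {s(1, 1)} := by
      by_contra hne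
      refine hg (measure_mono_null ?_ (ae_iff.1 hG.init))
      rintro ω rfl h1
      exact hne h1
    rw [h1]
    exact sq_tailDeviation_singleton_le_one hδ hm
  | succ n hn ih =>
    intro m hm
    -- Degrees at time `n + 1` are at most `n + 2`. Higher levels, and level 1 where the deviation
    -- vanishes, are bounded directly; the others satisfy the condition for convex weights.
    rcases lt_or_ge (n + 1 + 1) m with hlt | hge
    · refine (hle (n + 1) (by omega) m fun g hg => ?_).trans ?_
      · exact (hG.isAttachmentState hδ (by omega) g hg).sq_tailDeviation_le_one hδ hlt
      · exact_mod_cast (by omega : 1 ≤ n + 1)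
    obtain ⟨m, rfl⟩ := Nat.exists_eq_add_of_le' hm
    rcases Nat.eq_zero_or_pos m with rfl | hm
    · refine (hle (n + 1) (by omega) _ fun g hg => ?_).trans ?_
      · rw [zero_add, (hG.isAttachmentState hδ (by omega) g hg).tailDeviation_one]
        norm_num
      · exact_mod_cast (by omega : 1 ≤ n + 1)
    have hn' : (1 : ℝ) ≤ n := by exact_mod_cast hn
    have hm' : (1 : ℝ) ≤ m := by exact_mod_cast hm
    have hmn' : (m : ℝ) ≤ n + 1 := by exact_mod_cast (by omega : m ≤ n + 1)
    have hd : 0 < (2 + δ) * n := mul_pos (by linarith) (by linarith)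
    rw [hG.tsum_succ hδ hn]
    set a := (m + δ) / ((2 + δ) * n) with ha
    have ha0 : 0 ≤ a := div_nonneg (by linarith) hd.le
    have ha1 : 0 ≤ 1 - a := by
      rw [sub_nonneg, ha, div_le_one hd]
      nlinarith
    -- The noise bound `1 / 4` is relaxed to `1`, the increment of the claimed bound `n`.
    have hpt : ∀ g, P {ω | G n ω = g} * ∑ i ∈ Finset.Icc 1 n,
        ENNReal.ofReal (attachProb δ n g i) *
          ENNReal.ofReal (tailDeviation δ (n + 1) (m + 1) (s(n + 1, i) ::ₘ g) ^ 2) ≤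
        ENNReal.ofReal (1 - a) *
            (P {ω | G n ω = g} * ENNReal.ofReal (tailDeviation δ n (m + 1) g ^ 2)) +
          ENNReal.ofReal a * (P {ω | G n ω = g} * ENNReal.ofReal (tailDeviation δ n m g ^ 2)) +
          P {ω | G n ω = g} := by
      intro g
      rcases eq_or_ne (P {ω | G n ω = g}) 0 with hP | hP
      · simp [hP]
      have hg := hG.isAttachmentState hδ hn g hP
      calc _ = P {ω | G n ω = g} * ENNReal.ofReal (∑ i ∈ Finset.Icc 1 n,
            attachProb δ n g i * tailDeviation δ (n + 1) (m + 1) (s(n + 1, i) ::ₘ g) ^ 2) := by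
            rw [ENNReal.ofReal_sum_of_nonneg fun i hi =>
              mul_nonneg (hg.attachProb_nonneg hδ hi) (sq_nonneg _)]
            congr 1
            exact Finset.sum_congr rfl fun i hi =>
              (ENNReal.ofReal_mul (hg.attachProb_nonneg hδ hi)).symm
        _ ≤ P {ω | G n ω = g} * ENNReal.ofReal ((1 - a) * tailDeviation δ n (m + 1) g ^ 2 +
              a * tailDeviation δ n m g ^ 2 + 1) := by
            gcongr
            refine (hg.sum_attachProb_mul_sq_le hδ hn hm (by omega)).trans ?_
            rw [← ha]
            linarith
        _ = _ := by
            rw [ENNReal.ofReal_add (by positivity) zero_le_one,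
              ENNReal.ofReal_add (by positivity) (by positivity), ENNReal.ofReal_mul ha1,
              ENNReal.ofReal_mul ha0, ENNReal.ofReal_one]
            ring
    refine (ENNReal.tsum_le_tsum hpt).trans ?_
    rw [ENNReal.tsum_add, ENNReal.tsum_add, ENNReal.tsum_mul_left, ENNReal.tsum_mul_left,
      hG.tsum_measure_eq_one hn, Nat.cast_add, Nat.cast_one]
    gcongr
    calc _ ≤ ENNReal.ofReal (1 - a) * n + ENNReal.ofReal a * n := by
          gcongr
          · exact ih (m + 1) (by omega)
          · exact ih m hm
      _ = n := by
          rw [← add_mul, ← ENNReal.ofReal_add ha1 ha0, sub_add_cancel, ENNReal.ofReal_one, one_mul]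

/-- Chebyshev's inequality for the number of vertices of degree at least `m`. -/
theorem measure_le_abs_tailDeviation_le (hG : IsPreferentialAttachmentA P δ G) (hδ : -1 < δ)
    {n m : ℕ} (hn : 1 ≤ n) (hm : 1 ≤ m) {c : ℝ} (hc : 0 < c) :
    P {ω | c ≤ |tailDeviation δ n m (G n ω)|} ≤ ENNReal.ofReal (n / c ^ 2) := by
  have hunion : {ω | c ≤ |tailDeviation δ n m (G n ω)|} ⊆
      ⋃ g, {ω | G n ω = g ∧ c ≤ |tailDeviation δ n m g|} := by
    intro ω hω
    exact Set.mem_iUnion.2 ⟨G n ω, rfl, hω⟩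
  have hc2 : 0 < c ^ 2 := by positivity
  calc P {ω | c ≤ |tailDeviation δ n m (G n ω)|}
      ≤ ∑' g, P {ω | G n ω = g ∧ c ≤ |tailDeviation δ n m g|} :=
        (measure_mono hunion).trans (measure_iUnion_le _)
    _ ≤ ∑' g, P {ω | G n ω = g} * ENNReal.ofReal (tailDeviation δ n m g ^ 2) *
          (ENNReal.ofReal (c ^ 2))⁻¹ := by
        refine ENNReal.tsum_le_tsum fun g => ?_
        by_cases h : c ≤ |tailDeviation δ n m g|
        · simp only [h, and_true]
          rw [mul_assoc, ← div_eq_mul_inv]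
          refine le_mul_of_one_le_right' ?_
          rw [ENNReal.le_div_iff_mul_le (Or.inl (by simpa using hc.ne'))
            (Or.inl ENNReal.ofReal_ne_top), one_mul]
          refine ENNReal.ofReal_le_ofReal ?_
          rw [← sq_abs (tailDeviation δ n m g)]
          gcongr
        · simp [h]
    _ ≤ n * (ENNReal.ofReal (c ^ 2))⁻¹ := by
        rw [ENNReal.tsum_mul_right]
        gcongr
        exact hG.tsum_sq_tailDeviation_le hδ hn m hm
    _ = ENNReal.ofReal (n / c ^ 2) := by
        rw [ENNReal.ofReal_div_of_pos hc2, ENNReal.ofReal_natCast, div_eq_mul_inv]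

end IsPreferentialAttachmentA

/-! ## Order statistics -/

/-- In a decreasing list the entries at least `m` form an initial segment. The default 0 past the
end is below `m`, consistently with the count. -/
theorem le_getD_iff_lt_countP {l : List ℕ} (hl : l.Pairwise (· ≥ ·)) {m : ℕ}
    (hm : 1 ≤ m) (i : ℕ) : m ≤ l.getD i 0 ↔ i < l.countP (fun x => decide (m ≤ x)) := by
  induction l generalizing i with
  | nil =>
    simp
    omega
  | cons a l ih =>
    rw [List.pairwise_cons] at hl
    rw [List.countP_cons]
    by_cases ha : m ≤ a
    · cases i with
      | zero => simp [ha]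
      | succ i => simp [ha, ← ih hl.2 i]
    · have h0 : l.countP (fun x => decide (m ≤ x)) = 0 := by
        rw [List.countP_eq_zero]
        intro x hx
        have := hl.1 x hx
        simp
        omega
      cases i with
      | zero =>
        simp [ha]
        intro x hx
        have := hl.1 x hx
        omega
      | succ i =>
        have := ih hl.2 i
        rw [h0] at this
        rw [List.getD_cons_succ, h0, if_neg (by simpa using ha)]
        omega

namespace LabelledMultigraph

theorem le_orderedDegree_iff (g : LabelledMultigraph) {n m j : ℕ} (hm : 1 ≤ m) (hj : 1 ≤ j) :
    m ≤ g.orderedDegree n j ↔ j ≤ g.tailCount n m := by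
  rw [orderedDegree, le_getD_iff_lt_countP (Multiset.pairwise_sort _ _) hm, ← Multiset.coe_countP,
    Multiset.sort_eq, Multiset.countP_map, tailCount, Finset.card_def, Finset.filter_val]
  omega

end LabelledMultigraph

/-! ## Events with probability tending to one -/

/-- The events `p n` hold with `P`-probability tending to one. -/
def HoldsWhp {Ω : Type*} [MeasurableSpace Ω] (P : Measure Ω) (p : ℕ → Ω → Prop) : Prop :=
  Tendsto (fun n => P {ω | ¬ p n ω}) atTop (𝓝 0)

namespace HoldsWhp

variable {Ω : Type*} [MeasurableSpace Ω] {P : Measure Ω} {p q : ℕ → Ω → Prop}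

theorem mono (hp : HoldsWhp P p) (h : ∀ᶠ n in atTop, ∀ ω, p n ω → q n ω) : HoldsWhp P q :=
  tendsto_of_tendsto_of_tendsto_of_le_of_le' tendsto_const_nhds hp
    (Eventually.of_forall fun _ => zero_le)
    (h.mono fun _ hn => measure_mono fun ω hω hpω => hω (hn ω hpω))

theorem and (hp : HoldsWhp P p) (hq : HoldsWhp P q) : HoldsWhp P fun n ω => p n ω ∧ q n ω := by
  have h := Tendsto.add hp hq
  rw [add_zero] at h
  refine tendsto_of_tendsto_of_tendsto_of_le_of_le tendsto_const_nhds h (fun _ => zero_le)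
    fun n => (measure_mono ?_).trans (measure_union_le _ _)
  intro ω hω
  by_cases h : p n ω
  · exact Or.inr fun h' => hω ⟨h, h'⟩
  · exact Or.inl h

theorem of_eventually (h : ∀ᶠ n in atTop, ∀ ω, p n ω) : HoldsWhp P p := by
  refine tendsto_const_nhds.congr' (h.mono fun n hn => ?_)
  simp [hn]

theorem tendstoInMeasure {f : ℕ → Ω → ℝ} {c : ℝ}
    (h : ∀ ε, 0 < ε → HoldsWhp P fun n ω => |f n ω - c| < ε) :
    TendstoInMeasure P f atTop fun _ => c := by
  rw [tendstoInMeasure_iff_norm]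
  intro ε hε
  refine (h ε hε).congr fun n => ?_
  simp

end HoldsWhp

/-! ## Degree counts and order statistics at the scale `b(n / k)` -/

/-- The growth conditions on the number of upper order statistics. -/
structure IsIntermediate (k : ℕ → ℕ) : Prop where
  tendsto_atTop : Tendsto k atTop atTop
  tendsto_div : Tendsto (fun n : ℕ => (n : ℝ) / k n) atTop atTop
  tendsto_div_sq : Tendsto (fun n : ℕ => (n : ℝ) / (k n : ℝ) ^ 2) atTop (𝓝 0)

theorem isIntermediate_of_liminf {k : ℕ → ℕ}
    (hk_liminf : 0 < Filter.liminf
      (fun n : ℕ => (((k n : ℝ) / √((n : ℝ) * Real.log n) : ℝ) : EReal)) atTop)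
    (hk_zero : Tendsto (fun n : ℕ => (k n : ℝ) / n) atTop (𝓝 0)) : IsIntermediate k := by
  -- A real `c` exists even if the liminf is `⊤`. Eventually `k_n² ≥ c² n log n`, which yields all
  -- the growth needed.
  obtain ⟨c, hc0, hc⟩ := EReal.lt_iff_exists_real_btwn.1 hk_liminf
  have hc0' : 0 < c := by exact_mod_cast hc0
  have hlog : Tendsto (fun n : ℕ => Real.log n) atTop atTop :=
    Real.tendsto_log_atTop.comp tendsto_natCast_atTop_atTop
  have hlow : ∀ᶠ n : ℕ in atTop, c * √((n : ℝ) * Real.log n) < k n ∧ 1 < Real.log n ∧ 0 < n := by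
    filter_upwards [eventually_lt_of_lt_liminf hc, hlog.eventually_gt_atTop 1,
      eventually_gt_atTop 0] with n h1 h2 h3
    have h1' : c < (k n : ℝ) / √((n : ℝ) * Real.log n) := by exact_mod_cast h1
    have h3' : (0 : ℝ) < n := by exact_mod_cast h3
    exact ⟨(lt_div_iff₀ (by positivity)).1 h1', h2, h3⟩
  have hpos : ∀ᶠ n : ℕ in atTop, 0 < (k n : ℝ) := by
    filter_upwards [hlow] with n hn
    exact lt_of_le_of_lt (by positivity) hn.1
  refine ⟨?_, ?_, ?_⟩
  · rw [← tendsto_natCast_atTop_iff (R := ℝ)]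
    have h1 : Tendsto (fun n : ℕ => c * √(n : ℝ)) atTop atTop :=
      (Real.tendsto_sqrt_atTop.comp tendsto_natCast_atTop_atTop).const_mul_atTop hc0'
    refine tendsto_atTop_mono' _ ?_ h1
    filter_upwards [hlow] with n hn
    refine le_trans ?_ hn.1.le
    gcongr
    exact le_mul_of_one_le_right n.cast_nonneg hn.2.1.le
  · have h1 : Tendsto (fun n : ℕ => ((k n : ℝ) / n)⁻¹) atTop atTop := by
      refine tendsto_inv_nhdsGT_zero.comp (tendsto_nhdsWithin_iff.2 ⟨hk_zero, ?_⟩)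
      filter_upwards [hpos, eventually_gt_atTop 0] with n h1 h2
      have h2' : (0 : ℝ) < n := by exact_mod_cast h2
      exact div_pos h1 h2'
    simpa using h1
  · have h1 : Tendsto (fun n : ℕ => (c ^ 2 * Real.log n)⁻¹) atTop (𝓝 0) :=
      tendsto_inv_atTop_zero.comp (hlog.const_mul_atTop (by positivity))
    refine squeeze_zero' (Eventually.of_forall fun n => by positivity) ?_ h1
    filter_upwards [hlow, hpos] with n hn hk
    have h3 : (0 : ℝ) < n := by exact_mod_cast hn.2.2
    have h4 : 0 < Real.log n := by linarith [hn.2.1]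
    have h5 : (c * √((n : ℝ) * Real.log n)) ^ 2 ≤ (k n : ℝ) ^ 2 := by
      gcongr
      exact hn.1.le
    rw [mul_pow, Real.sq_sqrt (by positivity)] at h5
    rw [div_le_iff₀ (by positivity), ← div_eq_inv_mul, le_div_iff₀ (by positivity)]
    linarith

namespace IsIntermediate

variable {k : ℕ → ℕ}

theorem eventually_pos (hk : IsIntermediate k) : ∀ᶠ n in atTop, 0 < (k n : ℝ) := by
  filter_upwards [hk.tendsto_atTop.eventually_gt_atTop 0] with n hn
  exact_mod_cast hn

theorem eventually_scaleB_pos (hk : IsIntermediate k) {δ : ℝ} (hδ : -1 < δ) :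
    ∀ᶠ n : ℕ in atTop, 0 < scaleB δ ((n : ℝ) / k n) := by
  filter_upwards [hk.tendsto_div.eventually_gt_atTop 0] with n hn
  exact scaleB_pos hδ hn

theorem tendsto_floor_div (hk : IsIntermediate k) {t : ℝ} (ht : 0 < t) :
    Tendsto (fun n => (⌊(k n : ℝ) * t⌋₊ : ℝ) / k n) atTop (𝓝 t) := by
  have h := (tendsto_nat_floor_mul_div_atTop ht.le).comp
    (tendsto_natCast_atTop_atTop (R := ℝ) |>.comp hk.tendsto_atTop)
  refine h.congr fun n => ?_
  simp [mul_comm]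

theorem eventually_one_le_floor (hk : IsIntermediate k) {t : ℝ} (ht : 0 < t) :
    ∀ᶠ n in atTop, 1 ≤ ⌊(k n : ℝ) * t⌋₊ := by
  have h : Tendsto (fun n => (k n : ℝ) * t) atTop atTop :=
    (tendsto_natCast_atTop_atTop (R := ℝ) |>.comp hk.tendsto_atTop).atTop_mul_const ht
  filter_upwards [h.eventually_ge_atTop 1] with n hn
  exact Nat.le_floor (by simpa using hn)

end IsIntermediate

namespace IsPreferentialAttachmentA

open LabelledMultigraph

variable {Ω : Type*} [MeasurableSpace Ω] {P : Measure Ω} [IsProbabilityMeasure P] {δ : ℝ}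
  {G : ℕ → Ω → LabelledMultigraph} {k : ℕ → ℕ}

/-- The error splits into a random part, handled by Chebyshev, and a deterministic part, handled by
the asymptotics of `tailWeight`. -/
theorem holdsWhp_tailCount (hG : IsPreferentialAttachmentA P δ G) (hδ : -1 < δ)
    (hk : IsIntermediate k) {y ε : ℝ} (hy : 0 < y) (hε : 0 < ε) :
    HoldsWhp P fun n ω =>
      |((G n ω).tailCount n ⌈y * scaleB δ ((n : ℝ) / k n)⌉₊ : ℝ) / k n - y ^ (-(2 + δ))| < ε := by
  have h1 : HoldsWhp P fun n ω =>
      |tailDeviation δ n ⌈y * scaleB δ ((n : ℝ) / k n)⌉₊ (G n ω)| < ε / 2 * k n := by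
    have h2 := ENNReal.tendsto_ofReal ((hk.tendsto_div_sq.div_const ((ε / 2) ^ 2)))
    rw [zero_div, ENNReal.ofReal_zero] at h2
    refine tendsto_of_tendsto_of_tendsto_of_le_of_le' tendsto_const_nhds h2
      (Eventually.of_forall fun _ => zero_le) ?_
    filter_upwards [eventually_ge_atTop 1, hk.eventually_pos,
      hk.eventually_scaleB_pos hδ] with n hn hkn hb
    simp only [not_lt]
    refine (hG.measure_le_abs_tailDeviation_le hδ hn (Nat.ceil_pos.2 (by positivity))
      (by positivity)).trans_eq ?_
    congr 1
    field_simp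
  have h3 := (tendsto_mul_tailWeight_ceil hδ hk.tendsto_div hy)
  rw [Metric.tendsto_atTop'] at h3
  obtain ⟨N, hN⟩ := h3 (ε / 2) (by positivity)
  refine h1.mono ?_
  filter_upwards [eventually_gt_atTop N, hk.eventually_pos] with n hn hkn ω hω
  have h4 := hN n hn
  rw [Real.dist_eq] at h4
  have h5 : |tailDeviation δ n ⌈y * scaleB δ ((n : ℝ) / k n)⌉₊ (G n ω) / k n| < ε / 2 := by
    rwa [abs_div, abs_of_pos hkn, div_lt_iff₀ hkn]
  have h6 : ((G n ω).tailCount n ⌈y * scaleB δ ((n : ℝ) / k n)⌉₊ : ℝ) / k n - y ^ (-(2 + δ)) =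
      tailDeviation δ n ⌈y * scaleB δ ((n : ℝ) / k n)⌉₊ (G n ω) / k n +
        ((n : ℝ) / k n * tailWeight δ ⌈y * scaleB δ ((n : ℝ) / k n)⌉₊ - y ^ (-(2 + δ))) := by
    rw [tailDeviation]
    ring
  rw [h6]
  refine (abs_add_le _ _).trans_lt ?_
  linarith

theorem holdsWhp_orderedDegree_lt (hG : IsPreferentialAttachmentA P δ G) (hδ : -1 < δ)
    (hk : IsIntermediate k) {y t : ℝ} (hy : 0 < y) (ht : 0 < t) (hyt : y ^ (-(2 + δ)) < t) :
    HoldsWhp P fun n ω =>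
      ((G n ω).orderedDegree n ⌊(k n : ℝ) * t⌋₊ : ℝ) < y * scaleB δ ((n : ℝ) / k n) := by
  -- `r` separates the limit of the normalized count from the limit `t` of the normalized rank, so
  -- the count eventually falls short of the rank.
  obtain ⟨r, hr1, hr2⟩ := exists_between hyt
  refine (hG.holdsWhp_tailCount hδ hk hy (sub_pos.2 hr1)).mono ?_
  filter_upwards [hk.eventually_pos, hk.eventually_scaleB_pos hδ, hk.eventually_one_le_floor ht,
    (hk.tendsto_floor_div ht).eventually_const_lt hr2] with n h1 h2 h3 h4 ω hω
  rw [← Nat.lt_ceil, ← not_le, le_orderedDegree_iff _ (Nat.ceil_pos.2 (by positivity)) h3]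
  intro hle
  have h5 : (⌊(k n : ℝ) * t⌋₊ : ℝ) / k n ≤
      ((G n ω).tailCount n ⌈y * scaleB δ ((n : ℝ) / k n)⌉₊ : ℝ) / k n := by
    gcongr
  linarith [(abs_lt.1 hω).2]

theorem holdsWhp_le_orderedDegree (hG : IsPreferentialAttachmentA P δ G) (hδ : -1 < δ)
    (hk : IsIntermediate k) {y t : ℝ} (hy : 0 < y) (ht : 0 < t) (hyt : t < y ^ (-(2 + δ))) :
    HoldsWhp P fun n ω =>
      y * scaleB δ ((n : ℝ) / k n) ≤ ((G n ω).orderedDegree n ⌊(k n : ℝ) * t⌋₊ : ℝ) := by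
  obtain ⟨r, hr1, hr2⟩ := exists_between hyt
  refine (hG.holdsWhp_tailCount hδ hk hy (sub_pos.2 hr2)).mono ?_
  filter_upwards [hk.eventually_pos, hk.eventually_scaleB_pos hδ, hk.eventually_one_le_floor ht,
    (hk.tendsto_floor_div ht).eventually_lt_const hr1] with n h1 h2 h3 h4 ω hω
  rw [← Nat.ceil_le, le_orderedDegree_iff _ (Nat.ceil_pos.2 (by positivity)) h3]
  have h5 : (⌊(k n : ℝ) * t⌋₊ : ℝ) / k n ≤
      ((G n ω).tailCount n ⌈y * scaleB δ ((n : ℝ) / k n)⌉₊ : ℝ) / k n := by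
    linarith [(abs_lt.1 hω).1]
  rw [div_le_div_iff_of_pos_right h1] at h5
  exact_mod_cast h5

theorem holdsWhp_orderedDegree_div (hG : IsPreferentialAttachmentA P δ G) (hδ : -1 < δ)
    (hk : IsIntermediate k) {t ε : ℝ} (ht : 0 < t) (hε : 0 < ε) :
    HoldsWhp P fun n ω =>
      |((G n ω).orderedDegree n ⌊(k n : ℝ) * t⌋₊ : ℝ) / scaleB δ ((n : ℝ) / k n) -
        t ^ (-(1 / (2 + δ)))| < ε := by
  have hα : 0 < 2 + δ := by linarith
  set s := t ^ (-(1 / (2 + δ))) with hs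
  have hs0 : 0 < s := Real.rpow_pos_of_pos ht _
  have hst : s ^ (-(2 + δ)) = t := by
    rw [hs, ← Real.rpow_mul ht.le, neg_mul_neg, one_div_mul_cancel hα.ne', Real.rpow_one]
  -- The maximum with 0 keeps the lower level positive when `ε ≥ s`.
  obtain ⟨y, hy1, hy2⟩ := exists_between (show max 0 (s - ε) < s from max_lt hs0 (by linarith))
  have hy0 : 0 < y := (le_max_left _ _).trans_lt hy1
  have hyt : t < y ^ (-(2 + δ)) := by
    rw [← hst]
    exact Real.rpow_lt_rpow_of_neg hy0 hy2 (by linarith)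
  have hzt : (s + ε / 2) ^ (-(2 + δ)) < t := by
    conv_rhs => rw [← hst]
    exact Real.rpow_lt_rpow_of_neg hs0 (by linarith) (by linarith)
  refine ((hG.holdsWhp_le_orderedDegree hδ hk hy0 ht hyt).and
    (hG.holdsWhp_orderedDegree_lt hδ hk (by positivity) ht hzt)).mono ?_
  filter_upwards [hk.eventually_scaleB_pos hδ] with n hb ω hω
  rw [← le_div_iff₀ hb, ← div_lt_iff₀ hb] at hω
  have := (le_max_right _ _).trans_lt hy1
  rw [abs_lt]
  constructor <;> linarith [hω.1, hω.2]

end IsPreferentialAttachmentA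

/-! ## Vague convergence on `(0, ∞]` -/

namespace PosExtended

/-- The set `(x, ∞]`. -/
def tail (x : ℝ) : Set PosExtended := {y | ENNReal.ofReal x < y.1}

theorem measurableSet_tail (x : ℝ) : MeasurableSet (tail x) :=
  (isOpen_Ioi.preimage continuous_subtype_val).measurableSet

/-- Inversion identifies `(0, ∞]` with `[0, ∞)`, turning tails into initial intervals. -/
theorem mem_tail_inv {r : ℝ} (hr : 0 < r) (y : PosExtended) :
    y ∈ tail r⁻¹ ↔ (y.1⁻¹).toReal < r := by
  have hy : y.1⁻¹ ≠ ∞ := ENNReal.inv_ne_top.2 (ne_of_gt y.2)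
  rw [tail, Set.mem_ofPred_eq, ENNReal.ofReal_inv_of_pos hr, ENNReal.inv_lt_iff_inv_lt,
    ENNReal.lt_ofReal_iff_toReal_lt hy]

theorem isCompact_setOf_le {x : ℝ} (hx : 0 < x) :
    IsCompact {y : PosExtended | ENNReal.ofReal x ≤ y.1} := by
  rw [Topology.IsInducing.subtypeVal.isCompact_iff]
  have h : Subtype.val '' {y : PosExtended | ENNReal.ofReal x ≤ y.1} =
      Set.Ici (ENNReal.ofReal x) := by
    ext z
    refine ⟨fun ⟨y, hy, hyz⟩ => hyz ▸ hy, fun hz => ⟨⟨z, ?_⟩, hz, rfl⟩⟩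
    exact lt_of_lt_of_le (ENNReal.ofReal_pos.2 hx) hz
  rw [h]
  exact isClosed_Ici.isCompact

theorem measure_tail_ne_top (μ : RadonMeasures PosExtended) {x : ℝ} (hx : 0 < x) :
    μ.1 (tail x) ≠ ∞ := by
  have := μ.2
  have h : tail x ⊆ {y : PosExtended | ENNReal.ofReal x ≤ y.1} :=
    fun y (hy : ENNReal.ofReal x < y.1) => show ENNReal.ofReal x ≤ y.1 from hy.le
  exact ((measure_mono h).trans_lt (isCompact_setOf_le hx).measure_lt_top).ne

/-- The coordinate attains a positive minimum on the compact support. -/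
theorem exists_forall_ne_zero_mem_tail (f : C_c(PosExtended, ℝ)) :
    ∃ S : ℝ, 0 < S ∧ ∀ y, f y ≠ 0 → y ∈ tail S⁻¹ := by
  rcases (tsupport f).eq_empty_or_nonempty with h | h
  · refine ⟨1, one_pos, fun y hy => ?_⟩
    have := subset_tsupport f hy
    rw [h] at this
    exact this.elim
  · have hc : IsCompact (tsupport f) := f.hasCompactSupport
    obtain ⟨y₀, hy₀, hmin⟩ := hc.exists_isMinOn h continuous_subtype_val.continuousOn
    obtain ⟨a, ha0, ha⟩ := ENNReal.lt_iff_exists_real_btwn.1 (show (0 : ℝ≥0∞) < y₀.1 from y₀.2)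
    refine ⟨a⁻¹, inv_pos.2 (ENNReal.ofReal_pos.1 ha.1), fun y hy => ?_⟩
    rw [inv_inv]
    exact ha.2.trans_le (hmin (subset_tsupport f hy))

theorem sum_range_sub_mul_indicator (u : ℕ → ℝ) (j₀ M : ℕ) :
    ∑ j ∈ Finset.range M, (if j₀ ≤ j then u j - u (j + 1) else 0) =
      if j₀ ≤ M then u j₀ - u M else 0 := by
  induction M with
  | zero =>
    rcases Nat.eq_zero_or_pos j₀ with rfl | h
    · simp
    · simp [h.ne']
  | succ M ih =>
    rw [Finset.sum_range_succ, ih]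
    rcases lt_trichotomy j₀ (M + 1) with h | rfl | h
    · rw [if_pos (by omega), if_pos (by omega), if_pos (by omega)]
      ring
    · simp
    · rw [if_neg (by omega), if_neg (by omega), if_neg (by omega), add_zero]

/-- A compactly supported continuous function is uniformly close to a linear combination of
indicators of sets `(x, ∞]`. -/
theorem exists_sum_indicator_tail (f : C_c(PosExtended, ℝ)) :
    ∃ a : ℝ, 0 < a ∧ ∀ ε : ℝ, 0 < ε → ∃ (N : ℕ) (c x : ℕ → ℝ), (∀ j, 0 < x j) ∧
      ∀ y, ‖f y - ∑ j ∈ Finset.range N, (tail (x j)).indicator (fun _ => c j) y‖ ≤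
        (tail a).indicator (fun _ => ε) y := by
  obtain ⟨S, hS, hf⟩ := exists_forall_ne_zero_mem_tail f
  -- The tail carrying the error is fixed before `ε`, so its mass does not depend on the accuracy.
  refine ⟨S⁻¹, inv_pos.2 hS, fun ε hε => ?_⟩
  -- `f` in the coordinate `s = 1 / y`, with `s = 0` corresponding to `y = ∞`; uniform continuity on
  -- `[0, S]` is then available.
  let h : ℝ → ℝ := fun s => f ⟨(ENNReal.ofReal s)⁻¹, ENNReal.inv_pos.2 ENNReal.ofReal_ne_top⟩
  have hcont : Continuous h := by
    refine f.continuous.comp (Continuous.subtype_mk ?_ _)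
    exact continuous_inv.comp ENNReal.continuous_ofReal
  have hfh : ∀ y : PosExtended, f y = h (y.1⁻¹).toReal := by
    intro y
    have hy : y.1⁻¹ ≠ ∞ := ENNReal.inv_ne_top.2 (ne_of_gt y.2)
    refine congrArg f (Subtype.ext ?_)
    change y.1 = (ENNReal.ofReal (y.1⁻¹).toReal)⁻¹
    rw [ENNReal.ofReal_toReal hy, inv_inv]
  have huc := isCompact_Icc.uniformContinuousOn_of_continuous (hcont.continuousOn (s := Icc 0 S))
  rw [Metric.uniformContinuousOn_iff] at huc
  obtain ⟨η, hη, hδ⟩ := huc ε hε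
  obtain ⟨N, hN⟩ := exists_nat_gt (S / η)
  have hN0 : (0 : ℝ) < N := lt_trans (by positivity) hN
  have hmesh : S / N < η := by
    rw [div_lt_iff₀ hN0, mul_comm]
    exact (div_lt_iff₀ hη).1 hN
  let s : ℕ → ℝ := fun j => j * (S / N)
  have hsS : s N = S := by
    simp only [s]
    field_simp
  have hs0 : ∀ j, 0 < s (j + 1) := fun j => by
    simp only [s]
    positivity
  have hmono : Monotone s := fun i j hij => by
    simp only [s]
    gcongr
  -- The coefficients are increments of `h` on a mesh of width `S / N`. At a point of cell `j₀` the
  -- indicators with `j ≥ j₀` are active and telescope to `h (s j₀) - h S = h (s j₀)`.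
  refine ⟨N, fun j => h (s j) - h (s (j + 1)), fun j => (s (j + 1))⁻¹,
    fun j => inv_pos.2 (hs0 j), fun y => ?_⟩
  classical
  simp only [Set.indicator_apply, mem_tail_inv (hs0 _), mem_tail_inv hS]
  set σ := (y.1⁻¹).toReal with hσ
  have hσ0 : 0 ≤ σ := ENNReal.toReal_nonneg
  have hzero : ∀ z : PosExtended, S ≤ (z.1⁻¹).toReal → f z = 0 := by
    intro z hz
    by_contra hne
    exact absurd ((mem_tail_inv hS z).1 (hf z hne)) (not_lt.2 hz)
  by_cases hlt : σ < S
  · set j₀ := ⌊σ / (S / N)⌋₊ with hj₀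
    have hSN : 0 < S / N := by positivity
    have hj1 : s j₀ ≤ σ := (le_div_iff₀ hSN).1 (Nat.floor_le (by positivity))
    have hj2 : σ < s (j₀ + 1) := by
      have := (div_lt_iff₀ hSN).1 (Nat.lt_floor_add_one (σ / (S / N)))
      simpa [s] using this
    have hj3 : j₀ < N := by
      by_contra hle
      have := hmono (not_lt.1 hle)
      linarith
    have hiff : ∀ j, σ < s (j + 1) ↔ j₀ ≤ j := by
      intro j
      constructor
      · intro hj
        by_contra hlt'
        have := hmono (show j + 1 ≤ j₀ by omega)
        linarith
      · intro hj
        exact hj2.trans_le (hmono (by omega))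
    have hhN : h (s N) = 0 := by
      refine hzero _ ?_
      simp [hsS, hS.le]
    simp only [hiff]
    rw [sum_range_sub_mul_indicator (fun j => h (s j)), if_pos hj3.le, if_pos hlt, hhN, sub_zero,
      hfh]
    refine (hδ σ ⟨hσ0, hlt.le⟩ (s j₀) ⟨?_, ?_⟩ ?_).le
    · simp only [s]
      positivity
    · linarith
    · rw [Real.dist_eq, abs_of_nonneg (by linarith)]
      have : s (j₀ + 1) = s j₀ + S / N := by
        simp only [s]
        push_cast
        ring
      linarith
  · rw [if_neg hlt, Finset.sum_eq_zero, sub_zero, hzero y (not_lt.1 hlt), norm_zero]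
    intro j hj
    rw [if_neg]
    have := hmono (show j + 1 ≤ N by simpa using hj)
    linarith

/-- Convergence of the measures of all sets `(x, ∞]` implies vague convergence. -/
theorem tendsto_of_tendsto_tail {ι : Type*} {l : Filter ι} {μ : ι → RadonMeasures PosExtended}
    {ν : RadonMeasures PosExtended}
    (h : ∀ x, 0 < x → Tendsto (fun i => (μ i).1.real (tail x)) l (𝓝 (ν.1.real (tail x)))) :
    Tendsto μ l (𝓝 ν) := by
  rw [nhds_induced, tendsto_comap_iff, tendsto_pi_nhds]
  intro f
  obtain ⟨a, ha, hf⟩ := exists_sum_indicator_tail f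
  have hbound : ∀ {ε : ℝ} {N : ℕ} {c x : ℕ → ℝ}, (∀ j, 0 < x j) →
      (∀ y, ‖f y - ∑ j ∈ Finset.range N, (tail (x j)).indicator (fun _ => c j) y‖ ≤
        (tail a).indicator (fun _ => ε) y) → ∀ μ : RadonMeasures PosExtended,
      |∫ y, f y ∂μ.1 - ∑ j ∈ Finset.range N, μ.1.real (tail (x j)) * c j| ≤
        μ.1.real (tail a) * ε := by
    intro ε N c x hx hy μ
    have := μ.2
    have hint : ∀ j, Integrable ((tail (x j)).indicator (fun _ => c j)) μ.1 := fun j =>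
      (integrable_indicator_iff (measurableSet_tail _)).2
        (integrableOn_const (measure_tail_ne_top μ (hx j)))
    have h1 : ∑ j ∈ Finset.range N, μ.1.real (tail (x j)) * c j =
        ∫ y, ∑ j ∈ Finset.range N, (tail (x j)).indicator (fun _ => c j) y ∂μ.1 := by
      rw [integral_finsetSum _ fun j _ => hint j]
      exact Finset.sum_congr rfl fun j _ =>
        (integral_indicator_const (c j) (measurableSet_tail _)).symm
    have h2 : μ.1.real (tail a) * ε = ∫ y, (tail a).indicator (fun _ => ε) y ∂μ.1 :=
      (integral_indicator_const ε (measurableSet_tail _)).symm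
    have hf' : Integrable (fun y => f y) μ.1 :=
      f.continuous.integrable_of_hasCompactSupport f.hasCompactSupport
    rw [h1, h2, ← integral_sub hf' (integrable_finsetSum _ fun j _ => hint j)]
    refine norm_integral_le_of_norm_le ?_ (Eventually.of_forall hy)
    exact (integrable_indicator_iff (measurableSet_tail _)).2
      (integrableOn_const (measure_tail_ne_top μ ha))
  rw [Metric.tendsto_nhds]
  intro ε hε
  have hm : 0 ≤ ν.1.real (tail a) := measureReal_nonneg
  -- Eventually the tail at `a` has mass below `ν (tail a) + 1`, so each approximation error is at
  -- most `ε / 3`.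
  obtain ⟨N, c, x, hx, hy⟩ := hf (ε / (3 * (ν.1.real (tail a) + 1))) (by positivity)
  have hsum : Tendsto (fun i => ∑ j ∈ Finset.range N, (μ i).1.real (tail (x j)) * c j) l
      (𝓝 (∑ j ∈ Finset.range N, ν.1.real (tail (x j)) * c j)) :=
    tendsto_finsetSum _ fun j _ => (h (x j) (hx j)).mul_const (c j)
  have hthird : (ν.1.real (tail a) + 1) * (ε / (3 * (ν.1.real (tail a) + 1))) = ε / 3 := by
    field_simp
  have hεpos : 0 ≤ ε / (3 * (ν.1.real (tail a) + 1)) := by positivity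
  filter_upwards [(h a ha).eventually_lt_const (lt_add_one _),
    Metric.tendsto_nhds.1 hsum (ε / 3) (by positivity)] with i h1 h2
  have h3 := hbound hx hy (μ i)
  have h4 := hbound hx hy ν
  have h5 := mul_le_mul_of_nonneg_right h1.le hεpos
  have h6 := mul_le_mul_of_nonneg_right (lt_add_one (ν.1.real (tail a))).le hεpos
  rw [Real.dist_eq] at h2 ⊢
  rw [abs_lt] at h2 ⊢
  rw [abs_le] at h3 h4
  simp only [Function.comp]
  constructor <;> linarith [h2.1, h2.2, h3.1, h3.2, h4.1, h4.2]

end PosExtended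

/-! ## Convergence in distribution to a constant -/

/-- The filter of events whose probability tends to one. -/
def whpFilter {Ω : Type*} [MeasurableSpace Ω] (P : Measure Ω) : Filter (ℕ × Ω) where
  sets := {A | HoldsWhp P fun n ω => (n, ω) ∈ A}
  univ_sets := HoldsWhp.of_eventually (by simp)
  sets_of_superset := fun hA hAB => hA.mono (Eventually.of_forall fun _ _ h => hAB h)
  inter_sets := fun hA hB => hA.and hB

/-- By the open-set portmanteau criterion only open sets containing `c` matter, and each is a
neighbourhood of `c`. No metric on `E` enters. -/
theorem tendstoInDistribution_const_of_tendsto_whpFilter {Ω E : Type*} [MeasurableSpace Ω]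
    {P : Measure Ω} [IsProbabilityMeasure P] [TopologicalSpace E] [MeasurableSpace E]
    [OpensMeasurableSpace E] {X : ℕ → Ω → E} {c : E} (hX : ∀ n, AEMeasurable (X n) P)
    (h : Tendsto (fun x : ℕ × Ω => X x.1 x.2) (whpFilter P) (𝓝 c)) :
    TendstoInDistribution X atTop (fun _ : Ω => c) (fun _ => P) P where
  forall_aemeasurable := hX
  aemeasurable_limit := aemeasurable_const
  tendsto := by
    refine tendsto_of_forall_isOpen_le_liminf' fun U hU => ?_
    simp only [ProbabilityMeasure.coe_mk]
    rw [Measure.map_apply_of_aemeasurable aemeasurable_const hU.measurableSet]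
    by_cases hc : c ∈ U
    · have h1 : HoldsWhp P fun n ω => X n ω ∈ U := h (hU.mem_nhds hc)
      have h2 : Tendsto (fun n => 1 - P {ω | ¬ X n ω ∈ U}) atTop (𝓝 (1 - 0)) :=
        ENNReal.Tendsto.sub tendsto_const_nhds h1 (Or.inl ENNReal.one_ne_top)
      rw [tsub_zero] at h2
      refine prob_le_one.trans (h2.liminf_eq.symm.le.trans (liminf_le_liminf ?_))
      refine Eventually.of_forall fun n => ?_
      rw [Measure.map_apply_of_aemeasurable (hX n) hU.measurableSet, tsub_le_iff_right,
        ← measure_univ (μ := P)]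
      refine (measure_mono fun ω _ => ?_).trans (measure_union_le _ _)
      exact em (X n ω ∈ U)
    · simp [hc]

/-! ## The tail empirical measure -/

namespace LabelledMultigraph

theorem real_tailEmpiricalMeasure_tail (g : LabelledMultigraph) {n k : ℕ} {x : ℝ}
    (hx : 0 < x) (hD : 0 < g.orderedDegree n k) :
    (tailEmpiricalMeasure g n k).1.real (PosExtended.tail x) =
      (((Finset.Icc 1 n).filter fun i =>
        x * (g.orderedDegree n k : ℝ) < g.degree i).card : ℝ) / k := by
  have himage : Subtype.val '' PosExtended.tail x = Set.Ioi (ENNReal.ofReal x) := by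
    ext z
    refine ⟨fun ⟨y, hy, hyz⟩ => hyz ▸ hy, fun hz => ⟨⟨z, ?_⟩, hz, rfl⟩⟩
    exact lt_of_le_of_lt (zero_le (a := ENNReal.ofReal x)) hz
  have hiff : ∀ i, ((g.degree i : ℝ≥0∞) / (g.orderedDegree n k : ℝ≥0∞) ∈
      Set.Ioi (ENNReal.ofReal x)) ↔ x * (g.orderedDegree n k : ℝ) < g.degree i := by
    intro i
    rw [Set.mem_Ioi, ENNReal.lt_div_iff_mul_lt (Or.inl (by exact_mod_cast hD.ne'))
      (Or.inl (ENNReal.natCast_ne_top _)), ← ENNReal.ofReal_natCast, ← ENNReal.ofReal_natCast,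
      ← ENNReal.ofReal_mul hx.le, ENNReal.ofReal_lt_ofReal_iff_of_nonneg (by positivity)]
  have hmeas : (tailEmpiricalMeasure g n k).1 (PosExtended.tail x) =
      ((k : ℝ≥0)⁻¹ : ℝ≥0) * (((Finset.Icc 1 n).filter fun i =>
        x * (g.orderedDegree n k : ℝ) < g.degree i).card : ℝ≥0∞) := by
    rw [tailEmpiricalMeasure, restrictPosExtended,
      (MeasurableEmbedding.subtype_coe measurableSet_Ioi).comap_apply, himage,
      Measure.smul_apply, Measure.finsetSum_apply, ENNReal.smul_def, smul_eq_mul,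
      Finset.card_filter, Nat.cast_sum]
    congr 1
    refine Finset.sum_congr rfl fun i _ => ?_
    rw [Measure.dirac_apply' _ measurableSet_Ioi, Set.indicator_apply]
    simp only [hiff]
    split_ifs <;> simp
  rw [Measure.real, hmeas, ENNReal.toReal_mul, ENNReal.coe_toReal, ENNReal.toReal_natCast,
    NNReal.coe_inv, NNReal.coe_natCast]
  ring

end LabelledMultigraph

theorem real_nuMeasure_tail {α x : ℝ} (hα : 0 < α) (hx : 0 < x) :
    (nuMeasure α).1.real (PosExtended.tail x) = x ^ (-α) := by
  rw [Measure.real, nuMeasure, PosExtended.tail, powerMeasure_Ioi hα hx,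
    ENNReal.toReal_ofReal (by positivity)]

namespace IsPreferentialAttachmentA

open LabelledMultigraph

variable {Ω : Type*} [MeasurableSpace Ω] {P : Measure Ω} {δ : ℝ}
  {G : ℕ → Ω → LabelledMultigraph}

/-- Every subset of a countable state space is a countable union of atoms, so the Borel structure of
the vague topology need not be examined. -/
theorem measurable_comp (hG : IsPreferentialAttachmentA P δ G) {E : Type*} [MeasurableSpace E]
    {n : ℕ} (hn : 1 ≤ n) (φ : LabelledMultigraph → E) : Measurable fun ω => φ (G n ω) := by
  intro A _
  have h : (fun ω => φ (G n ω)) ⁻¹' A = ⋃ g ∈ φ ⁻¹' A, {ω | G n ω = g} := by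
    ext ω
    simp
  rw [h]
  exact MeasurableSet.biUnion (Set.to_countable _) fun g _ => hG.measurableSet_eq n hn g

theorem measurable_tailEmpiricalMeasure (hG : IsPreferentialAttachmentA P δ G) (k : ℕ → ℕ)
    (n : ℕ) : Measurable fun ω => tailEmpiricalMeasure (G n ω) n (k n) := by
  -- Nothing is assumed about `G 0`, but the empty sum makes the measure constant.
  rcases Nat.eq_zero_or_pos n with rfl | hn
  · have h : ∀ g, tailEmpiricalMeasure g 0 (k 0) = tailEmpiricalMeasure 0 0 (k 0) := fun g => by
      simp [tailEmpiricalMeasure]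
    simp only [h]
    exact measurable_const
  · exact hG.measurable_comp hn fun g => tailEmpiricalMeasure g n (k n)

variable [IsProbabilityMeasure P] {k : ℕ → ℕ}

theorem holdsWhp_tailEmpiricalMeasure_tail (hG : IsPreferentialAttachmentA P δ G) (hδ : -1 < δ)
    (hk : IsIntermediate k) {x ε : ℝ} (hx : 0 < x) (hε : 0 < ε) :
    HoldsWhp P fun n ω =>
      |(tailEmpiricalMeasure (G n ω) n (k n)).1.real (PosExtended.tail x) - x ^ (-(2 + δ))| <
        ε := by
  have hcont : ContinuousAt (fun y : ℝ => y ^ (-(2 + δ))) x :=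
    Real.continuousAt_rpow_const x _ (Or.inl hx.ne')
  obtain ⟨η, hη, hηx⟩ := Metric.continuousAt_iff.1 hcont (ε / 2) (by positivity)
  -- Small enough for continuity of the power at `x` and for `x - ρ` to stay positive.
  set ρ := min (η / 2) (x / 2) with hρ
  have hρ0 : 0 < ρ := lt_min (by positivity) (by positivity)
  have hρη : ρ < η := (min_le_left _ _).trans_lt (by linarith)
  have hρx : ρ < x := (min_le_right _ _).trans_lt (by linarith)
  have hlow := hηx (show dist (x - ρ) x < η by
    rw [Real.dist_eq, sub_sub_cancel_left, abs_neg, abs_of_pos hρ0]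
    exact hρη)
  have hupp := hηx (show dist (x + ρ) x < η by
    rw [Real.dist_eq, add_sub_cancel_left, abs_of_pos hρ0]
    exact hρη)
  rw [Real.dist_eq, abs_lt] at hlow hupp
  -- Tolerance `1` for `D_(k) / b` forces `D_(k) > 0`; tolerance `ρ / x` puts `x D_(k)` between `(x
  -- - ρ) b` and `(x + ρ) b`.
  refine (((hG.holdsWhp_tailCount hδ hk (sub_pos.2 hρx) (half_pos hε)).and
    (hG.holdsWhp_tailCount hδ hk (add_pos hx hρ0) (half_pos hε))).and
    (hG.holdsWhp_orderedDegree_div hδ hk one_pos (lt_min one_pos (div_pos hρ0 hx)))).mono ?_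
  filter_upwards [hk.eventually_pos, hk.eventually_scaleB_pos hδ] with n hkn hb ω hω
  obtain ⟨⟨h1, h2⟩, h3⟩ := hω
  rw [Real.one_rpow, mul_one, Nat.floor_natCast] at h3
  set b := scaleB δ ((n : ℝ) / k n) with hbdef
  set D := (G n ω).orderedDegree n (k n) with hDdef
  obtain ⟨h4, h5⟩ := abs_lt.1 (h3.trans_le (min_le_left _ _))
  obtain ⟨h6, h7⟩ := abs_lt.1 (h3.trans_le (min_le_right _ _))
  have hD0 : 0 < (D : ℝ) := by
    have : 0 < (D : ℝ) / b := by linarith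
    exact (div_pos_iff_of_pos_right hb).1 this
  have hlowD : (x - ρ) * b < x * D := by
    have h8 : 1 - ρ / x < (D : ℝ) / b := by linarith
    rw [lt_div_iff₀ hb] at h8
    have h9 := mul_lt_mul_of_pos_left h8 hx
    have h10 : x * ((1 - ρ / x) * b) = (x - ρ) * b := by
      field_simp
    linarith
  have huppD : x * D < (x + ρ) * b := by
    have h8 : (D : ℝ) / b < 1 + ρ / x := by linarith
    rw [div_lt_iff₀ hb] at h8
    have h9 := mul_lt_mul_of_pos_left h8 hx
    have h10 : x * ((1 + ρ / x) * b) = (x + ρ) * b := by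
      field_simp
    linarith
  rw [real_tailEmpiricalMeasure_tail _ hx (by exact_mod_cast hD0)]
  have hle1 : ((G n ω).tailCount n ⌈(x + ρ) * b⌉₊ : ℝ) / k n ≤
      (((Finset.Icc 1 n).filter fun i => x * (D : ℝ) < (G n ω).degree i).card : ℝ) / k n := by
    gcongr
    refine Finset.card_le_card (Finset.monotone_filter_right _ fun i _ hi => ?_)
    exact huppD.trans_le (Nat.ceil_le.1 hi)
  have hle2 : (((Finset.Icc 1 n).filter fun i => x * (D : ℝ) < (G n ω).degree i).card : ℝ) / k n ≤
      ((G n ω).tailCount n ⌈(x - ρ) * b⌉₊ : ℝ) / k n := by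
    gcongr
    refine Finset.card_le_card (Finset.monotone_filter_right _ fun i _ hi => ?_)
    exact Nat.ceil_le.2 (hlowD.trans hi).le
  rw [abs_lt] at h1 h2 ⊢
  constructor <;> linarith [h1.2, h2.1, hlow.2, hupp.1]

/-- The deterministic tail criterion holds along any filter, so with `whpFilter` the one-level
estimates suffice, without uniformity in `x`. -/
theorem tendsto_tailEmpiricalMeasure (hG : IsPreferentialAttachmentA P δ G) (hδ : -1 < δ)
    (hk : IsIntermediate k) :
    Tendsto (fun x : ℕ × Ω => tailEmpiricalMeasure (G x.1 x.2) x.1 (k x.1)) (whpFilter P)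
      (𝓝 (nuMeasure (2 + δ))) := by
  refine PosExtended.tendsto_of_tendsto_tail fun x hx => ?_
  rw [real_nuMeasure_tail (by linarith) hx, Metric.tendsto_nhds]
  exact fun ε hε => hG.holdsWhp_tailEmpiricalMeasure_tail hδ hk hx hε

end IsPreferentialAttachmentA

theorem mainTheorem2 {Ω : Type*} [MeasurableSpace Ω] (P : Measure Ω) [IsProbabilityMeasure P]
    (δ : ℝ) (hδ : -1 < δ) (G : ℕ → Ω → LabelledMultigraph)
    (hG : IsPreferentialAttachmentA P δ G) (k : ℕ → ℕ)
    (hk_liminf : 0 < Filter.liminf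
      (fun n : ℕ => (((k n : ℝ) / √((n : ℝ) * Real.log n) : ℝ) : EReal)) atTop)
    (hk_zero : Tendsto (fun n : ℕ => (k n : ℝ) / n) atTop (𝓝 0)) :
    TendstoInDistribution (fun n ω => tailEmpiricalMeasure (G n ω) n (k n)) atTop
        (fun _ : Ω => nuMeasure (2 + δ)) (fun _ => P) P ∧
      ∀ t : ℝ, 0 < t →
        TendstoInMeasure P
          (fun n ω => ((G n ω).orderedDegree n ⌊(k n : ℝ) * t⌋₊ : ℝ) / scaleB δ ((n : ℝ) / k n))
          atTop (fun _ => t ^ (-(1 / (2 + δ)))) := by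
  have hk := isIntermediate_of_liminf hk_liminf hk_zero
  refine ⟨tendstoInDistribution_const_of_tendsto_whpFilter
    (fun n => (hG.measurable_tailEmpiricalMeasure k n).aemeasurable)
    (hG.tendsto_tailEmpiricalMeasure hδ hk), fun t ht => HoldsWhp.tendstoInMeasure fun ε hε => ?_⟩
  exact hG.holdsWhp_orderedDegree_div hδ hk ht hε
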